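/- Let $\mathfrak g$ be a complex semisimple Lie algebra with Cartan subalgebra $\mathfrak h$ and Chevalley generators $e_i,f_i,h_i$ ($i\in\mathrm I$), where the $h_i$ span $\mathfrak h$, $[e_i,f_i]=h_i$, and $\alpha_i$ is the simple root of $e_i$. Let $\mathfrak g=\mathfrak u^-\oplus\mathfrak h\oplus\mathfrak u^+$, where $\mathfrak u^{\pm}$ is the sum of the positive (negative) root spaces, and put $\mathfrak b^\pm=\mathfrak h\oplus\mathfrak u^\pm$. Let $G$ be the connected adjoint group with Lie algebra $\mathfrak g$, and $x_i(\xi)=\exp(\xi e_i)$, $y_i(\xi)=\exp(\xi f_i)$, $\dot s_i=x_i(1)y_i(-1)x_i(1)$. *The dual Lie algebra.* Let $\langle\ ,\ \rangle$ be the Killing form and equip the double $\mathfrak g\oplus\mathfrak g$ with the form $\langle\langle (X_1,Y_1),(X_2,Y_2)\rangle\rangle=\langle X_1,X_2\rangle-\langle Y_1,Y_2\rangle$. The Lie subalgebra $$\{(X,Y)\in\mathfrak b^+\times\mathfrak b^-\mid \text{the }\mathfrak h\text{-component of }X+Y\text{ is }0\}\subset\mathfrak g\oplus\mathfrak g$$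 is identified with the dual space $\mathfrak g^*$ by letting $(X,Y)$ correspond to the linear form $Z\mapsto\langle\langle (X,Y),(Z,Z)\rangle\rangle$; this makes $\mathfrak g^*$ a Lie algebra (the dual of the standard Lie bialgebra $\mathfrak g$). *The involution.* Let $(\mathrm I=\mathrm I_\circ\sqcup\mathrm I_\bullet,\tau)$ be a Satake diagram: $\tau$ is an involution of the Dynkin diagram preserving $\mathrm I_\bullet$, $w_\bullet(\alpha_j)=-\alpha_{\tau j}$ for $j\in\mathrm I_\bullet$, where $w_\bullet$ is the longest element of the parabolic Weyl group $W_\bullet=\langle s_j\mid j\in \mathrm I_\bullet\rangle$, and $\langle\rho_\bullet^\vee,\alpha_i\rangle\in\mathbb Z$ for all $i\in\mathrm I_\circ$ with $\tau i=i$, where $2\rho_\bullet^\vee$ is the sum of the positive coroots of the subsystem spanned by $\mathrm I_\bullet$. Let $\dot w_\bullet\in G$ be the product of the $\dot s_i$ along a reduced expression of $w_\bullet$. Let $c_i\in\{\pm1\}$ ($i\in\mathrm I_\circ$), and let $\theta:G\to G$ be a complex group involution such that $$\theta(x_i(\xi))=x_i(\xi),\quad \theta(y_i(\xi))=y_i(\xi)\qquad(i\in\mathrm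 I_\bullet,\ \xi\in\mathbb C),$$ $$\theta(x_i(\xi))=\dot w_\bullet\, y_{\tau i}(c_i\xi)\,\dot w_\bullet^{-1},\quad \theta(y_i(\xi))=\dot w_\bullet\, x_{\tau i}(c_i\xi)\,\dot w_\bullet^{-1}\qquad(i\in\mathrm I_\circ,\ \xi\in\mathbb C).$$ Write $\theta$ also for the induced Lie algebra homomorphism $\mathfrak g\to\mathfrak g$. Let $K=G^\theta$ be the fixed-point subgroup and $\mathfrak k$ its Lie algebra. **Proposition.** The closed subgroup $K$ is coisotropic, that is, $\mathfrak k^\perp=\{f\in\mathfrak g^*\mid f(X)=0\ \text{for all } X\in\mathfrak k\}$ is a Lie subalgebra of $\mathfrak g^*$. Moreover, under the identification of $\mathfrak g^*$ with the above subalgebra of $\mathfrak g\oplus\mathfrak g$, $$\mathfrak k^\perp=\{(X_1,X_2)\in\mathfrak g^*\mid X_1=\theta(X_2)\}.$$ -/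

import Mathlib

noncomputable section

/-! ### Weyl group combinatorics and Satake diagrams

`A i j` is the value `α_i (h_j)` of the `i`-th simple root on the `j`-th simple coroot. The root
lattice and the coroot lattice are both written as `ι → ℤ`, in the basis of the simple roots,
respectively of the simple coroots. -/

section Combinatorics

variable {ι : Type*} [Fintype ι] [DecidableEq ι]

/-- The simple reflection `s_i (v) = v - v (h_i) α_i` on the root lattice. For the transposed matrix
this is the simple reflection on the coroot lattice. -/
def simpleReflection (A : Matrix ι ι ℤ) (i : ι) : Module.End ℤ (ι → ℤ) where
  toFun v := v - (∑ j, v j * A j i) • Pi.single i 1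
  map_add' v w := by
    simp only [Pi.add_apply, add_mul, Finset.sum_add_distrib, add_smul]
    abel
  map_smul' r v := by
    simp only [Pi.smul_apply, smul_eq_mul, mul_assoc, ← Finset.mul_sum, mul_smul, smul_sub,
      RingHom.id_apply]

/-- The product `s_{i_1} ⋯ s_{i_k}` attached to a word `[i_1, …, i_k]`. -/
def wordProd (A : Matrix ι ι ℤ) (l : List ι) : Module.End ℤ (ι → ℤ) :=
  (l.map (simpleReflection A)).prod

/-- The word is a reduced expression of its product in the Weyl group. -/
def IsReducedWord (A : Matrix ι ι ℤ) (l : List ι) : Prop :=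
  ∀ l' : List ι, wordProd A l' = wordProd A l → l.length ≤ l'.length

/-- The word is a reduced expression of the longest element of the parabolic subgroup generated by
the simple reflections with index in `J`. -/
def IsReducedLongestWord (A : Matrix ι ι ℤ) (J : Set ι) (l : List ι) : Prop :=
  (∀ i ∈ l, i ∈ J) ∧ IsReducedWord A l ∧
    ∀ l' : List ι, (∀ i ∈ l', i ∈ J) → IsReducedWord A l' → l'.length ≤ l.length

/-- The positive coroots of the subsystem spanned by the simple roots with index in `J`. -/
def parabolicPositiveCoroots (A : Matrix ι ι ℤ) (J : Set ι) : Set (ι → ℤ) :=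
  {v | 0 ≤ v ∧ ∃ l : List ι, (∀ i ∈ l, i ∈ J) ∧
    ∃ j ∈ J, v = wordProd A.transpose l (Pi.single j 1)}

/-- The sum `2ρ^∨` of the positive coroots of the subsystem attached to `J`. -/
def parabolicTwoRhoCheck (A : Matrix ι ι ℤ) (J : Set ι) : ι → ℤ :=
  ∑ᶠ v ∈ parabolicPositiveCoroots A J, v

/-- A Satake diagram: black nodes `black` (the others are white) and a diagram
involution `τ` such that `τ` is minus the longest element of the parabolic Weyl group on the black
simple roots, and `⟨ρ_•^∨, α_i⟩` is an integer for every white node `i` fixed by `τ`. -/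
structure SatakeDiagram (A : Matrix ι ι ℤ) where
  black : Set ι
  τ : Equiv.Perm ι
  τ_invol : ∀ i, τ (τ i) = i
  τ_cartan : ∀ i j, A (τ i) (τ j) = A i j
  τ_black : ∀ i, τ i ∈ black ↔ i ∈ black
  longest_black : ∀ l, IsReducedLongestWord A black l →
    ∀ j ∈ black, wordProd A l (Pi.single j 1) = -Pi.single (τ j) 1
  rho_white : ∀ i, i ∉ black → τ i = i →
    (2 : ℤ) ∣ ∑ j, A i j * parabolicTwoRhoCheck A black j

end Combinatorics

/-! ### The adjoint group -/

section Group

variable {𝔤 : Type*} [LieRing 𝔤] [LieAlgebra ℂ 𝔤] [FiniteDimensional ℂ 𝔤]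

/-- The exponential `∑ Tⁿ / n!` of an endomorphism of a finite-dimensional complex vector space,
computed in coordinates. -/
def endExp (T : Module.End ℂ 𝔤) : Module.End ℂ 𝔤 :=
  Matrix.toLin (Module.finBasis ℂ 𝔤) (Module.finBasis ℂ 𝔤)
    (NormedSpace.exp (LinearMap.toMatrix (Module.finBasis ℂ 𝔤) (Module.finBasis ℂ 𝔤) T))

theorem endExp_mul_neg (T : Module.End ℂ 𝔤) : endExp T * endExp (-T) = 1 := by
  unfold endExp
  rw [Module.End.mul_eq_comp, ← Matrix.toLin_mul, map_neg]
  set M := LinearMap.toMatrix (Module.finBasis ℂ 𝔤) (Module.finBasis ℂ 𝔤) T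
  rw [← Matrix.exp_add_of_commute M (-M) ((Commute.refl M).neg_right), add_neg_cancel,
    NormedSpace.exp_zero, Matrix.toLin_one]
  rfl

/-- The invertible endomorphism `exp (ad X)` of `𝔤`. -/
def expAdUnit (X : 𝔤) : (Module.End ℂ 𝔤)ˣ where
  val := endExp (LieAlgebra.ad ℂ 𝔤 X)
  inv := endExp (-LieAlgebra.ad ℂ 𝔤 X)
  val_inv := endExp_mul_neg _
  inv_val := by simpa using endExp_mul_neg (-LieAlgebra.ad ℂ 𝔤 X)

variable (𝔤) in
/-- The connected group of adjoint type with Lie algebra `𝔤` (for `𝔤` semisimple): the group of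
inner automorphisms of `𝔤`, generated in `GL(𝔤)` by the `exp (ad X)`. -/
def AdjointGroup : Subgroup (Module.End ℂ 𝔤)ˣ :=
  Subgroup.closure (Set.range expAdUnit)

/-- The exponential map `𝔤 → G` of the adjoint group. -/
def adjExp (X : 𝔤) : AdjointGroup 𝔤 :=
  ⟨expAdUnit X, Subgroup.subset_closure ⟨X, rfl⟩⟩

/-- The Lie algebra of a closed subgroup `K` of the adjoint group: all `X` whose one-parameter
subgroup lies in `K`. -/
def lieAlgebraOf (K : Subgroup (AdjointGroup 𝔤)) : Set 𝔤 :=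
  {X | ∀ t : ℂ, adjExp (t • X) ∈ K}

/-- The subgroup `G^θ` of fixed points. -/
def fixedSubgroup (θ : AdjointGroup 𝔤 ≃* AdjointGroup 𝔤) : Subgroup (AdjointGroup 𝔤) where
  carrier := {g | θ g = g}
  mul_mem' {a b} ha hb := by
    simp only [Set.mem_ofPred_eq] at ha hb ⊢
    rw [map_mul, ha, hb]
  one_mem' := map_one θ
  inv_mem' {a} ha := by
    simp only [Set.mem_ofPred_eq] at ha ⊢
    rw [map_inv, ha]

/-- `D` is the Lie algebra homomorphism induced by `θ`. -/
def IsInducedLieHom (θ : AdjointGroup 𝔤 ≃* AdjointGroup 𝔤) (D : 𝔤 →ₗ⁅ℂ⁆ 𝔤) : Prop :=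
  ∀ X : 𝔤, θ (adjExp X) = adjExp (D X)

end Group

/-! ### The involution attached to a Satake diagram

A `LieAlgebra.Basis` is a system of Chevalley generators `e_i, f_i, h_i`, where `H` is the Cartan
subalgebra spanned by the `h_i`. It provides the pinning `x_i, y_i` of the adjoint group. -/

section Pinning

variable {ι 𝔤 : Type*} [Fintype ι] [LieRing 𝔤] [LieAlgebra ℂ 𝔤] [FiniteDimensional ℂ 𝔤]
  {H : LieSubalgebra ℂ 𝔤}

/-- `x_i (ξ) = exp (ξ e_i)`. -/
def pinX (b : LieAlgebra.Basis ι H) (i : ι) (ξ : ℂ) : AdjointGroup 𝔤 := adjExp (ξ • b.e i)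

/-- `y_i (ξ) = exp (ξ f_i)`. -/
def pinY (b : LieAlgebra.Basis ι H) (i : ι) (ξ : ℂ) : AdjointGroup 𝔤 := adjExp (ξ • b.f i)

/-- The lift `x_i(1) y_i(-1) x_i(1)` of the simple reflection `s_i` to the group. -/
def simpleLift (b : LieAlgebra.Basis ι H) (i : ι) : AdjointGroup 𝔤 :=
  pinX b i 1 * pinY b i (-1) * pinX b i 1

/-- The product of the lifts of the simple reflections along a word. -/
def wordLift (b : LieAlgebra.Basis ι H) (l : List ι) : AdjointGroup 𝔤 :=
  (l.map (simpleLift b)).prod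

/-- The defining properties of the group involution `θ` of a Satake diagram with signs `c_i`;
`l` is a reduced expression of the longest element `w_•`, so that `wordLift b l` is its lift. -/
structure IsSatakeInvolution [DecidableEq ι] (b : LieAlgebra.Basis ι H) (S : SatakeDiagram b.A)
    (c : ι → ℂ) (l : List ι) (θ : AdjointGroup 𝔤 ≃* AdjointGroup 𝔤) : Prop where
  invol : ∀ g, θ (θ g) = g
  x_black : ∀ i ∈ S.black, ∀ ξ, θ (pinX b i ξ) = pinX b i ξ
  y_black : ∀ i ∈ S.black, ∀ ξ, θ (pinY b i ξ) = pinY b i ξ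
  x_white : ∀ i, i ∉ S.black → ∀ ξ,
    θ (pinX b i ξ) = wordLift b l * pinY b (S.τ i) (c i * ξ) * (wordLift b l)⁻¹
  y_white : ∀ i, i ∉ S.black → ∀ ξ,
    θ (pinY b i ξ) = wordLift b l * pinX b (S.τ i) (c i * ξ) * (wordLift b l)⁻¹

end Pinning

/-! ### The double and the dual Lie algebra -/

section Dual

variable {ι 𝔤 : Type*} [Fintype ι] [LieRing 𝔤] [LieAlgebra ℂ 𝔤] {H : LieSubalgebra ℂ 𝔤}

variable (𝔤) in
/-- The form `⟨⟨(X₁, Y₁), (X₂, Y₂)⟩⟩ = ⟨X₁, X₂⟩ - ⟨Y₁, Y₂⟩` on the double `𝔤 × 𝔤`, where `⟨ , ⟩` is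
the Killing form. -/
def doubleForm : LinearMap.BilinForm ℂ (𝔤 × 𝔤) :=
  (killingForm ℂ 𝔤).comp (LinearMap.fst ℂ 𝔤 𝔤) (LinearMap.fst ℂ 𝔤 𝔤) -
    (killingForm ℂ 𝔤).comp (LinearMap.snd ℂ 𝔤 𝔤) (LinearMap.snd ℂ 𝔤 𝔤)

/-- `𝔲⁺`, the sum of the positive root spaces, i.e. the subalgebra generated by the `e_i`. -/
def nilPos (b : LieAlgebra.Basis ι H) : Submodule ℂ 𝔤 := b.borelUpper.toSubmodule

/-- `𝔲⁻`, the sum of the negative root spaces, i.e. the subalgebra generated by the `f_i`. -/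
def nilNeg (b : LieAlgebra.Basis ι H) : Submodule ℂ 𝔤 := b.borelLower.toSubmodule

/-- `𝔟⁺ = 𝔥 ⊕ 𝔲⁺`. -/
def borelPos (b : LieAlgebra.Basis ι H) : Submodule ℂ 𝔤 := H.toSubmodule ⊔ nilPos b

/-- `𝔟⁻ = 𝔥 ⊕ 𝔲⁻`. -/
def borelNeg (b : LieAlgebra.Basis ι H) : Submodule ℂ 𝔤 := H.toSubmodule ⊔ nilNeg b

theorem lie_borelPos (b : LieAlgebra.Basis ι H) {x y : 𝔤} (hx : x ∈ borelPos b)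
    (hy : y ∈ borelPos b) : ⁅x, y⁆ ∈ nilPos b := by
  obtain ⟨h, hh, u, hu, rfl⟩ := Submodule.mem_sup.mp hx
  obtain ⟨k, hk, v, hv, rfl⟩ := Submodule.mem_sup.mp hy
  have h1 : ⁅h, v⁆ ∈ nilPos b := b.borelUpper.lie_mem (x := ⟨h, hh⟩) hv
  have h2 : ⁅k, u⁆ ∈ nilPos b := b.borelUpper.lie_mem (x := ⟨k, hk⟩) hu
  have h3 : ⁅u, v⁆ ∈ nilPos b :=
    LieSubalgebra.lie_mem (LieSubalgebra.lieSpan ℂ 𝔤 (Set.range b.e)) hu hv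
  have h4 : ⁅h, k⁆ = 0 := by
    have := b.isLieAbelian_cartan
    simpa using congrArg Subtype.val (trivial_lie_zero H H ⟨h, hh⟩ ⟨k, hk⟩)
  rw [add_lie, lie_add, lie_add, h4, zero_add, ← lie_skew u k]
  exact add_mem h1 (add_mem (neg_mem h2) h3)

theorem lie_borelNeg (b : LieAlgebra.Basis ι H) {x y : 𝔤} (hx : x ∈ borelNeg b)
    (hy : y ∈ borelNeg b) : ⁅x, y⁆ ∈ nilNeg b :=
  lie_borelPos b.symm hx hy

/-- The Lie subalgebra of all `(X, Y) ∈ 𝔟⁺ × 𝔟⁻` for which the `𝔥`-component of `X + Y` with respect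
to `𝔤 = 𝔲⁻ ⊕ 𝔥 ⊕ 𝔲⁺` vanishes. -/
def dualSubalgebra (b : LieAlgebra.Basis ι H) : LieSubalgebra ℂ (𝔤 × 𝔤) where
  carrier := {x | x.1 ∈ borelPos b ∧ x.2 ∈ borelNeg b ∧ x.1 + x.2 ∈ nilNeg b ⊔ nilPos b}
  add_mem' {x y} hx hy := ⟨add_mem hx.1 hy.1, add_mem hx.2.1 hy.2.1, by
    have := add_mem hx.2.2 hy.2.2
    rwa [add_add_add_comm] at this⟩
  zero_mem' := ⟨zero_mem _, zero_mem _, by simp⟩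
  smul_mem' t x hx := ⟨Submodule.smul_mem _ t hx.1, Submodule.smul_mem _ t hx.2.1, by
    simpa using Submodule.smul_mem _ t hx.2.2⟩
  lie_mem' {x y} hx hy := by
    have h1 := lie_borelPos b hx.1 hy.1
    have h2 := lie_borelNeg b hx.2.1 hy.2.1
    exact ⟨Submodule.mem_sup_right h1, Submodule.mem_sup_right h2,
      add_mem (Submodule.mem_sup_right h1) (Submodule.mem_sup_left h2)⟩

/-- The map `x ↦ (Z ↦ ⟨⟨x, (Z, Z)⟩⟩)` from the subalgebra above to the dual space of `𝔤`, which is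
identified with the diagonal of the double. -/
def toDualMap (b : LieAlgebra.Basis ι H) : dualSubalgebra b →ₗ[ℂ] Module.Dual ℂ 𝔤 where
  toFun x := (doubleForm 𝔤 (x : 𝔤 × 𝔤)).comp (LinearMap.prod LinearMap.id LinearMap.id)
  map_add' x y := by ext; simp
  map_smul' t x := by ext; simp

@[simp]
theorem toDualMap_apply (b : LieAlgebra.Basis ι H) (x : dualSubalgebra b) (Z : 𝔤) :
    toDualMap b x Z = doubleForm 𝔤 (x : 𝔤 × 𝔤) (Z, Z) := rfl

theorem toDualMap_apply' (b : LieAlgebra.Basis ι H) (x : dualSubalgebra b) (Z : 𝔤) :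
    toDualMap b x Z = killingForm ℂ 𝔤 (x.1.1 - x.1.2) Z := by
  simp [doubleForm]

/-- The dual space `𝔤^*` of all linear forms on `𝔤`, as a type that carries the Lie
bracket of the standard dual Lie bialgebra, the bracket transported along `toDualEquiv` below. -/
def DualLieAlgebra (_b : LieAlgebra.Basis ι H) : Type _ := Module.Dual ℂ 𝔤

instance (b : LieAlgebra.Basis ι H) : AddCommGroup (DualLieAlgebra b) :=
  inferInstanceAs (AddCommGroup (Module.Dual ℂ 𝔤))

instance (b : LieAlgebra.Basis ι H) : Module ℂ (DualLieAlgebra b) :=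
  inferInstanceAs (Module ℂ (Module.Dual ℂ 𝔤))

/-- The space `𝔨^⊥` of the linear forms on `𝔤` which vanish on `𝔨`. -/
def annihilator (b : LieAlgebra.Basis ι H) (𝔨 : Set 𝔤) : Submodule ℂ (DualLieAlgebra b) :=
  (Submodule.span ℂ 𝔨).dualAnnihilator

theorem mem_annihilator (b : LieAlgebra.Basis ι H) (𝔨 : Set 𝔤) (f : Module.Dual ℂ 𝔤) :
    (show DualLieAlgebra b from f) ∈ annihilator b 𝔨 ↔ ∀ X ∈ 𝔨, f X = 0 := by
  refine (Submodule.mem_dualAnnihilator f).trans ⟨fun h X hX => h X (Submodule.subset_span hX), ?_⟩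
  intro h X hX
  exact (Submodule.span_le (p := LinearMap.ker f)).mpr h hX

theorem triangular_indep (b : LieAlgebra.Basis ι H) {h u v : 𝔤} (hh : h ∈ H)
    (hu : u ∈ nilPos b) (hv : v ∈ nilNeg b) (h0 : h + v + u = 0) : h = 0 ∧ v = 0 ∧ u = 0 := by
  have key := b.iSupIndep_rootSpace
  rw [← b.cartan_eq, ← b.borelLower_eq, ← b.borelUpper_eq, iSupIndep_fin_three] at key
  obtain ⟨k1, k2, -⟩ := key
  have e1 : h = 0 := by
    have hm : h ∈ b.borelLower ⊔ b.borelUpper := by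
      have : h = -v + -u := by
        rw [add_assoc] at h0
        rw [eq_neg_of_add_eq_zero_left h0, neg_add]
      rw [this]
      exact add_mem (LieSubmodule.mem_sup_left (neg_mem hv))
        (LieSubmodule.mem_sup_right (neg_mem hu))
    have := (disjoint_iff.mp k1).le ⟨hh, hm⟩
    simpa using this
  subst e1
  have e2 : v = 0 := by
    have hm : v ∈ b.borelUpper ⊔ H.toLieSubmodule := by
      have : v = -u := eq_neg_of_add_eq_zero_left (by rwa [zero_add] at h0)
      rw [this]
      exact LieSubmodule.mem_sup_left (neg_mem hu)
    have := (disjoint_iff.mp k2).le ⟨hv, hm⟩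
    simpa using this
  subst e2
  exact ⟨rfl, rfl, by simpa using h0⟩

variable [FiniteDimensional ℂ 𝔤]

theorem toDualMap_bijective [LieAlgebra.IsSemisimple ℂ 𝔤] (b : LieAlgebra.Basis ι H) :
    Function.Bijective (toDualMap b) := by
  have nd := LieAlgebra.IsKilling.killingForm_nondegenerate ℂ 𝔤
  constructor
  · refine (injective_iff_map_eq_zero _).mpr fun x hx => ?_
    have hxy : (x : 𝔤 × 𝔤).1 - (x : 𝔤 × 𝔤).2 = 0 :=
      nd.1 _ fun Z => by rw [← toDualMap_apply', hx, LinearMap.zero_apply]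
    obtain ⟨⟨X, Y⟩, hX, hY, hXY⟩ := x
    obtain rfl : X = Y := sub_eq_zero.mp hxy
    obtain ⟨h, hh, u, hu, rfl⟩ := Submodule.mem_sup.mp hX
    obtain ⟨k, hk, v, hv, hkv⟩ := Submodule.mem_sup.mp hY
    obtain ⟨w, hw, z, hz, hwz⟩ := Submodule.mem_sup.mp hXY
    simp only at hkv hwz
    obtain ⟨-, -, hu0⟩ := triangular_indep b (h := h - k) (v := -v) (u := u) (sub_mem hh hk) hu
      (neg_mem hv) (by rw [sub_eq_add_neg, ← sub_eq_zero.mpr hkv.symm]; abel)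
    subst hu0
    obtain ⟨hh0, -, -⟩ := triangular_indep b (h := h + h) (v := -w) (u := -z) (add_mem hh hh)
      (neg_mem hz) (neg_mem hw) (by
        have : w + z = h + h := by rw [hwz, add_zero]
        rw [← this]; abel)
    have hh1 : h = 0 := by
      rw [← two_smul ℂ h] at hh0
      simpa using hh0
    subst hh1
    ext <;> simp
  · intro f
    obtain ⟨W, hW⟩ := ((killingForm ℂ 𝔤).toDual nd).surjective f
    have hWm : W ∈ H.toSubmodule ⊔ nilNeg b ⊔ nilPos b := by
      have h := congrArg LieSubmodule.toSubmodule b.iSup_cartan_borelLower_borelUpper_eq_top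
      have h' : H.toSubmodule ⊔ nilNeg b ⊔ nilPos b = ⊤ := by
        simpa [iSup_fin_three, nilNeg, nilPos] using h
      rw [h']
      trivial
    obtain ⟨a, ha, u, hu, rfl⟩ := Submodule.mem_sup.mp hWm
    obtain ⟨h, hh, v, hv, rfl⟩ := Submodule.mem_sup.mp ha
    have hh2 : (2⁻¹ : ℂ) • h ∈ H := H.smul_mem _ hh
    refine ⟨⟨((2⁻¹ : ℂ) • h + u, -((2⁻¹ : ℂ) • h) + -v), ?_, ?_, ?_⟩, ?_⟩
    · exact Submodule.add_mem_sup hh2 hu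
    · exact Submodule.add_mem_sup (neg_mem hh2) (neg_mem hv)
    · have e : (2⁻¹ : ℂ) • h + u + (-((2⁻¹ : ℂ) • h) + -v) = -v + u := by abel
      simp only [e]
      exact Submodule.add_mem_sup (neg_mem hv) hu
    · ext Z
      rw [toDualMap_apply', ← hW]
      have e : (2⁻¹ : ℂ) • h + u - (-((2⁻¹ : ℂ) • h) + -v) = h + v + u := by
        have : h = (2⁻¹ : ℂ) • h + (2⁻¹ : ℂ) • h := by
          rw [← add_smul]; norm_num
        nth_rewrite 3 [this]
        abel
      simp only [e, LinearMap.BilinForm.toDual_def]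

variable [LieAlgebra.IsSemisimple ℂ 𝔤]

/-- The identification of the subalgebra of the double with `𝔤^*` by means of `⟨⟨ , ⟩⟩`. -/
def toDualEquiv (b : LieAlgebra.Basis ι H) : dualSubalgebra b ≃ₗ[ℂ] Module.Dual ℂ 𝔤 :=
  LinearEquiv.ofBijective (toDualMap b) (toDualMap_bijective b)

/-- `toDualEquiv` with the Lie algebra `𝔤^*` as its target. -/
def toDualLie (b : LieAlgebra.Basis ι H) : dualSubalgebra b ≃ₗ[ℂ] DualLieAlgebra b :=
  toDualEquiv b

instance (b : LieAlgebra.Basis ι H) : LieRing (DualLieAlgebra b) where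
  bracket f g := toDualLie b ⁅(toDualLie b).symm f, (toDualLie b).symm g⁆
  add_lie f g h := by simp only [map_add, add_lie]
  lie_add f g h := by simp only [map_add, lie_add]
  lie_self f := by simp only [lie_self, map_zero]
  leibniz_lie f g h := by
    simp only [LinearEquiv.symm_apply_apply, ← map_add]
    rw [leibniz_lie]

instance (b : LieAlgebra.Basis ι H) : LieAlgebra ℂ (DualLieAlgebra b) where
  lie_smul t f g := by
    change toDualLie b _ = t • toDualLie b _
    simp only [map_smul, lie_smul]

/-- A closed subgroup `K` of the adjoint group is coisotropic if the annihilator of its Lie algebra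
is a Lie subalgebra of `𝔤^*`. -/
def IsCoisotropic (b : LieAlgebra.Basis ι H) (K : Subgroup (AdjointGroup 𝔤)) : Prop :=
  ∃ P : LieSubalgebra ℂ (DualLieAlgebra b), P.toSubmodule = annihilator b (lieAlgebraOf K)

end Dual

end

/-! Let `D` be the differential of `θ`. The Lie algebra of `K` is the fixed space of `D`. As the
Killing form is nondegenerate and `D` is an involutive isometry, a pair `(X₁, X₂)` annihilates it
exactly when `w = X₁ - X₂` satisfies `D w = -w` (`forall_killingForm_fixed_eq_zero_iff`). The
condition `X₁ = D X₂` gives this at once because `D² = 1`.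

The converse needs a grading, since `D` fixes the black root vectors and so does not simply exchange
the two nilpotent halves. Write `X₁ = h + u`, `X₂ = -h + v`, and choose `ρ` in the Cartan subalgebra
for which `e_i` has degree 0 for black `i` and degree 1 for white `i`. Two facts carry the proof.
(1) `w = 2h + u - v` is orthogonal to the subalgebras generated by the black `f_i` and by the black
`e_i`, which `D` fixes. So `u` has only positive degrees and `v` only negative ones
(`mem_positivePart_of_killingForm_eq_zero`). (2) `D` reverses degrees, because the lift of `w_•`
commutes with `ad ρ` (`IsSatakeInvolution.lie_map_eq_neg`). Comparing degrees in `D w = -w` gives `u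
= D v` and `D h = -h`, hence `X₁ = D X₂`. This equation is stable under the componentwise bracket,
which is coisotropy. -/

/-! ### From one-parameter subgroups to the Lie algebra. -/

section ExpAd

variable {𝔤 : Type*} [LieRing 𝔤] [LieAlgebra ℂ 𝔤] [FiniteDimensional ℂ 𝔤]

/-- Both sides are differentiable in `t`; their derivatives at `t = 0` are `A * W` and `W * B`. -/
theorem mul_eq_mul_of_exp_smul_mul_eq {𝔸 : Type*} [NormedRing 𝔸] [NormedAlgebra ℂ 𝔸]
    [CompleteSpace 𝔸] {A B W : 𝔸}
    (h : ∀ t : ℂ, NormedSpace.exp (t • A) * W = W * NormedSpace.exp (t • B)) :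
    A * W = W * B := by
  have hA := (hasDerivAt_exp_smul_const (𝕂 := ℂ) A 0).mul_const W
  have hB := (hasDerivAt_exp_smul_const (𝕂 := ℂ) B 0).const_mul W
  simp only [zero_smul, NormedSpace.exp_zero, one_mul] at hA hB
  rw [funext h] at hA
  exact hA.unique hB

-- The choice of norm is confined to this proof: the statement depends only on the topology of the
-- matrix space.
open scoped Matrix.Norms.Operator in
theorem Matrix.mul_eq_mul_of_exp_smul_mul_eq {n : Type*} [Fintype n] [DecidableEq n]
    {A B W : Matrix n n ℂ}
    (h : ∀ t : ℂ, NormedSpace.exp (t • A) * W = W * NormedSpace.exp (t • B)) :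
    A * W = W * B :=
  _root_.mul_eq_mul_of_exp_smul_mul_eq h

theorem toMatrix_endExp (T : Module.End ℂ 𝔤) :
    LinearMap.toMatrix (Module.finBasis ℂ 𝔤) (Module.finBasis ℂ 𝔤) (endExp T) =
      NormedSpace.exp (LinearMap.toMatrix (Module.finBasis ℂ 𝔤) (Module.finBasis ℂ 𝔤) T) :=
  LinearMap.toMatrix_toLin _ _ _

theorem mul_eq_mul_of_endExp_smul_mul_eq {A B W : Module.End ℂ 𝔤}
    (h : ∀ t : ℂ, endExp (t • A) * W = W * endExp (t • B)) : A * W = W * B := by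
  apply (LinearMap.toMatrix (Module.finBasis ℂ 𝔤) (Module.finBasis ℂ 𝔤)).injective
  rw [LinearMap.toMatrix_mul, LinearMap.toMatrix_mul]
  refine Matrix.mul_eq_mul_of_exp_smul_mul_eq fun t => ?_
  have := congrArg (LinearMap.toMatrix (Module.finBasis ℂ 𝔤) (Module.finBasis ℂ 𝔤)) (h t)
  rwa [LinearMap.toMatrix_mul, LinearMap.toMatrix_mul, toMatrix_endExp, toMatrix_endExp,
    map_smul, map_smul] at this

theorem Commute.endExp_right {A B : Module.End ℂ 𝔤} (h : Commute A B) :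
    Commute A (endExp B) := by
  apply (LinearMap.toMatrix (Module.finBasis ℂ 𝔤) (Module.finBasis ℂ 𝔤)).injective
  rw [LinearMap.toMatrix_mul, LinearMap.toMatrix_mul, toMatrix_endExp]
  refine (Commute.exp_right ?_).eq
  have := congrArg (LinearMap.toMatrix (Module.finBasis ℂ 𝔤) (Module.finBasis ℂ 𝔤)) h.eq
  rwa [LinearMap.toMatrix_mul, LinearMap.toMatrix_mul] at this

omit [FiniteDimensional ℂ 𝔤] in
theorem ad_injective_of_isSemisimple [LieAlgebra.IsSemisimple ℂ 𝔤] :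
    Function.Injective (LieAlgebra.ad ℂ 𝔤) := by
  refine (injective_iff_map_eq_zero _).mpr fun x hx => ?_
  have : x ∈ LieAlgebra.center ℂ 𝔤 := fun y => by
    rw [← lie_skew, ← LieAlgebra.ad_apply (R := ℂ), hx, LinearMap.zero_apply, neg_zero]
  rwa [LieAlgebra.center_eq_bot, LieSubmodule.mem_bot] at this

theorem coe_adjExp (X : 𝔤) :
    ((adjExp X : (Module.End ℂ 𝔤)ˣ) : Module.End ℂ 𝔤) = endExp (LieAlgebra.ad ℂ 𝔤 X) := rfl

/-- If conjugation by `g` carries one one-parameter subgroup into another, it does so for the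
generators. -/
theorem ad_mul_eq_of_adjExp_smul {X Y : 𝔤} {g : AdjointGroup 𝔤}
    (h : ∀ t : ℂ, adjExp (t • X) = g * adjExp (t • Y) * g⁻¹) :
    LieAlgebra.ad ℂ 𝔤 X * ((g : (Module.End ℂ 𝔤)ˣ) : Module.End ℂ 𝔤) =
      ((g : (Module.End ℂ 𝔤)ˣ) : Module.End ℂ 𝔤) * LieAlgebra.ad ℂ 𝔤 Y := by
  refine mul_eq_mul_of_endExp_smul_mul_eq fun t => ?_
  have := congrArg (fun k : AdjointGroup 𝔤 => ((k : (Module.End ℂ 𝔤)ˣ) : Module.End ℂ 𝔤))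
    (eq_mul_inv_iff_mul_eq.mp (h t))
  simpa [coe_adjExp] using this

variable [LieAlgebra.IsSemisimple ℂ 𝔤]

/-- Differentiation gives `ad X = ad Y`, and `ad` is injective because the centre is trivial. Group
relations between one-parameter subgroups thereby become equations in `𝔤`. -/
theorem eq_of_adjExp_smul_eq {X Y : 𝔤} (h : ∀ t : ℂ, adjExp (t • X) = adjExp (t • Y)) :
    X = Y := by
  have := ad_mul_eq_of_adjExp_smul (g := 1) (X := X) (Y := Y) (by simpa using h)
  exact ad_injective_of_isSemisimple (by simpa using this)

omit [LieAlgebra.IsSemisimple ℂ 𝔤] in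
theorem IsInducedLieHom.adjExp_smul {θ : AdjointGroup 𝔤 ≃* AdjointGroup 𝔤} {D : 𝔤 →ₗ⁅ℂ⁆ 𝔤}
    (hD : IsInducedLieHom θ D) (X : 𝔤) (t : ℂ) : θ (adjExp (t • X)) = adjExp (t • D X) := by
  rw [hD, map_smul]

theorem IsInducedLieHom.apply_apply {θ : AdjointGroup 𝔤 ≃* AdjointGroup 𝔤} {D : 𝔤 →ₗ⁅ℂ⁆ 𝔤}
    (hD : IsInducedLieHom θ D) (hθ : ∀ g, θ (θ g) = g) (X : 𝔤) : D (D X) = X :=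
  eq_of_adjExp_smul_eq fun t => by rw [← hD.adjExp_smul, ← hD.adjExp_smul, hθ]

theorem IsInducedLieHom.mem_lieAlgebraOf_fixedSubgroup {θ : AdjointGroup 𝔤 ≃* AdjointGroup 𝔤}
    {D : 𝔤 →ₗ⁅ℂ⁆ 𝔤} (hD : IsInducedLieHom θ D) (X : 𝔤) :
    X ∈ lieAlgebraOf (fixedSubgroup θ) ↔ D X = X := by
  constructor
  · intro h
    refine eq_of_adjExp_smul_eq fun t => ?_
    rw [← hD.adjExp_smul]
    exact h t
  · intro h t
    change θ _ = _
    rw [hD.adjExp_smul, h]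

/-- If `g` commutes with `ad ρ` and conjugates the one-parameter subgroup of `Y` into that of `X`,
then `X` and `Y` have the same weight for `ad ρ`. -/
theorem lie_eq_smul_of_adjExp_smul {ρ X Y : 𝔤} {g : AdjointGroup 𝔤} {k : ℂ}
    (hg : Commute (LieAlgebra.ad ℂ 𝔤 ρ) ((g : (Module.End ℂ 𝔤)ˣ) : Module.End ℂ 𝔤))
    (hY : ⁅ρ, Y⁆ = k • Y) (h : ∀ t : ℂ, adjExp (t • X) = g * adjExp (t • Y) * g⁻¹) :
    ⁅ρ, X⁆ = k • X := by
  have h1 := ad_mul_eq_of_adjExp_smul h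
  have h2 : LieAlgebra.ad ℂ 𝔤 ρ * LieAlgebra.ad ℂ 𝔤 Y -
      LieAlgebra.ad ℂ 𝔤 Y * LieAlgebra.ad ℂ 𝔤 ρ = k • LieAlgebra.ad ℂ 𝔤 Y := by
    ext Z
    have := leibniz_lie ρ Y Z
    rw [hY, smul_lie] at this
    simpa [sub_eq_iff_eq_add] using this
  have h3 : LieAlgebra.ad ℂ 𝔤 ⁅ρ, X⁆ = LieAlgebra.ad ℂ 𝔤 ρ * LieAlgebra.ad ℂ 𝔤 X -
      LieAlgebra.ad ℂ 𝔤 X * LieAlgebra.ad ℂ 𝔤 ρ := by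
    ext Z
    simp
  -- The weight equation may be checked after applying `ad` and multiplying on the right by the
  -- invertible `g`. Moving `g` to the left then turns `ad X` into `ad Y` and leaves `ad ρ`
  -- unchanged.
  apply ad_injective_of_isSemisimple
  rw [h3, map_smul, ← Units.mul_left_inj (g : (Module.End ℂ 𝔤)ˣ)]
  rw [sub_mul, mul_assoc, h1, mul_assoc, hg.eq, ← mul_assoc, ← mul_assoc, h1, hg.eq, mul_assoc,
    mul_assoc, ← mul_sub, h2, smul_mul_assoc, h1, mul_smul_comm]

end ExpAd

/-! ### Lifts of Weyl group elements and elements centralizing them. -/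

section Pinning

variable {ι 𝔤 : Type*} [Fintype ι] [LieRing 𝔤] [LieAlgebra ℂ 𝔤] [FiniteDimensional ℂ 𝔤]
  {H : LieSubalgebra ℂ 𝔤}

theorem commute_ad_adjExp {ρ X : 𝔤} (h : ⁅ρ, X⁆ = 0) :
    Commute (LieAlgebra.ad ℂ 𝔤 ρ) ((adjExp X : (Module.End ℂ 𝔤)ˣ) : Module.End ℂ 𝔤) := by
  rw [coe_adjExp]
  refine Commute.endExp_right ?_
  ext Z
  have := leibniz_lie ρ X Z
  rw [h, zero_lie, zero_add] at this
  simpa using this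

/-- The lift is a product of exponentials of multiples of `e_i` and `f_i` with `i` in the word, and
each of these commutes with `ρ`. -/
theorem commute_ad_wordLift (b : LieAlgebra.Basis ι H) {ρ : 𝔤} {l : List ι}
    (he : ∀ i ∈ l, ⁅ρ, b.e i⁆ = 0) (hf : ∀ i ∈ l, ⁅ρ, b.f i⁆ = 0) :
    Commute (LieAlgebra.ad ℂ 𝔤 ρ)
      ((wordLift b l : (Module.End ℂ 𝔤)ˣ) : Module.End ℂ 𝔤) := by
  induction l with
  | nil => simp [wordLift]
  | cons i l ih =>
    have hx : Commute (LieAlgebra.ad ℂ 𝔤 ρ)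
        ((pinX b i 1 : (Module.End ℂ 𝔤)ˣ) : Module.End ℂ 𝔤) :=
      commute_ad_adjExp (by simp [he i])
    have hy : Commute (LieAlgebra.ad ℂ 𝔤 ρ)
        ((pinY b i (-1) : (Module.End ℂ 𝔤)ˣ) : Module.End ℂ 𝔤) :=
      commute_ad_adjExp (by simp [hf i])
    have := ih (fun j hj => he j (List.mem_cons_of_mem i hj))
      (fun j hj => hf j (List.mem_cons_of_mem i hj))
    simpa [wordLift, simpleLift] using ((hx.mul_right hy).mul_right hx).mul_right this

end Pinning

/-! ### The grading by eigenvalues of `ad ρ`. -/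

section Grading

variable {𝔤 : Type*} [LieRing 𝔤] [LieAlgebra ℂ 𝔤]

/-- The sum of the eigenspaces of `ad ρ` with eigenvalues `1, 2, 3, …`. -/
def positivePart (ρ : 𝔤) : Submodule ℂ 𝔤 :=
  ⨆ n : ℕ, (LieAlgebra.ad ℂ 𝔤 ρ).eigenspace (n + 1)

theorem mem_eigenspace_ad_iff {ρ x : 𝔤} {k : ℂ} :
    x ∈ (LieAlgebra.ad ℂ 𝔤 ρ).eigenspace k ↔ ⁅ρ, x⁆ = k • x := by
  rw [Module.End.mem_eigenspace_iff, LieAlgebra.ad_apply]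

theorem mem_positivePart_of_lie_eq {ρ x : 𝔤} (n : ℕ) (h : ⁅ρ, x⁆ = ((n : ℂ) + 1) • x) :
    x ∈ positivePart ρ :=
  Submodule.mem_iSup_of_mem (p := fun n : ℕ => (LieAlgebra.ad ℂ 𝔤 ρ).eigenspace ((n : ℂ) + 1)) n
    (mem_eigenspace_ad_iff.mpr h)

@[elab_as_elim]
theorem positivePart_induction {ρ : 𝔤} {p : (x : 𝔤) → x ∈ positivePart ρ → Prop}
    (eigen : ∀ (n : ℕ) (y : 𝔤) (hy : ⁅ρ, y⁆ = ((n : ℂ) + 1) • y),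
      p y (mem_positivePart_of_lie_eq n hy))
    (zero : p 0 (zero_mem _))
    (add : ∀ y z hy hz, p y hy → p z hz → p (y + z) (add_mem hy hz))
    {x : 𝔤} (hx : x ∈ positivePart ρ) : p x hx :=
  Submodule.iSup_induction' (fun n : ℕ => (LieAlgebra.ad ℂ 𝔤 ρ).eigenspace ((n : ℂ) + 1))
    (fun n y hy => eigen n y (mem_eigenspace_ad_iff.mp hy)) zero add hx

theorem lie_eq_add_smul_of_lie_eq_smul {ρ x y : 𝔤} {k m : ℂ} (hx : ⁅ρ, x⁆ = k • x)
    (hy : ⁅ρ, y⁆ = m • y) : ⁅ρ, ⁅x, y⁆⁆ = (k + m) • ⁅x, y⁆ := by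
  rw [leibniz_lie, hx, hy, smul_lie, lie_smul, add_smul]

theorem lie_mem_positivePart_of_lie_eq_zero {ρ x y : 𝔤} (hx : ⁅ρ, x⁆ = 0)
    (hy : y ∈ positivePart ρ) : ⁅x, y⁆ ∈ positivePart ρ := by
  induction hy using positivePart_induction with
  | eigen n y hy =>
    refine mem_positivePart_of_lie_eq n ?_
    simpa using lie_eq_add_smul_of_lie_eq_smul (k := 0) (by simpa using hx) hy
  | zero => simp
  | add y z _ _ hy hz => rw [lie_add]; exact add_mem hy hz

theorem lie_mem_positivePart {ρ x y : 𝔤} (hx : x ∈ positivePart ρ) (hy : y ∈ positivePart ρ) :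
    ⁅x, y⁆ ∈ positivePart ρ := by
  induction hx using positivePart_induction with
  | eigen m x hx =>
    induction hy using positivePart_induction with
    | eigen n y hy =>
      refine mem_positivePart_of_lie_eq (m + n + 1) ?_
      rw [lie_eq_add_smul_of_lie_eq_smul hx hy]
      congr 1
      push_cast
      ring
    | zero => simp
    | add y z _ _ hy hz => rw [lie_add]; exact add_mem hy hz
  | zero => simp
  | add x z _ _ hx hz => rw [add_lie]; exact add_mem hx hz

/-- The relation exhibits `p` as a sum of eigenvectors with eigenvalues at most zero, while
eigenspaces for distinct eigenvalues are independent. -/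
theorem eq_zero_of_add_positivePart_add_positivePart_neg {ρ a p q : 𝔤} (ha : ⁅ρ, a⁆ = 0)
    (hp : p ∈ positivePart ρ) (hq : q ∈ positivePart (-ρ)) (h : a + p + q = 0) : p = 0 := by
  -- The second range starts at 0, so that it covers both `a` and the components of `q`.
  have hd : Disjoint (Set.range fun n : ℕ => (n : ℂ) + 1)
      (Set.range fun n : ℕ => -(n : ℂ)) := by
    rw [Set.disjoint_iff_forall_ne]
    rintro _ ⟨m, rfl⟩ _ ⟨n, rfl⟩ h
    have : ((m + 1 + n : ℕ) : ℂ) = 0 := by push_cast; linear_combination h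
    exact absurd (Nat.cast_eq_zero.mp this) (by omega)
  have key := (Module.End.eigenspaces_iSupIndep (LieAlgebra.ad ℂ 𝔤 ρ)).disjoint_biSup_biSup hd
  rw [iSup_range, iSup_range] at key
  refine Submodule.disjoint_def.mp key p hp ?_
  have hmem : ∀ (n : ℕ) (x : 𝔤), ⁅ρ, x⁆ = (-(n : ℂ)) • x →
      x ∈ ⨆ n : ℕ, (LieAlgebra.ad ℂ 𝔤 ρ).eigenspace (-(n : ℂ)) := fun n x hx =>
    Submodule.mem_iSup_of_mem (p := fun n : ℕ => (LieAlgebra.ad ℂ 𝔤 ρ).eigenspace (-(n : ℂ))) n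
      (mem_eigenspace_ad_iff.mpr hx)
  have hp' : p = -(a + q) := by
    rw [eq_neg_iff_add_eq_zero, ← h]; abel
  rw [hp']
  refine neg_mem (add_mem (hmem 0 a (by simpa using ha)) ?_)
  clear h hp'
  induction hq using positivePart_induction with
  | eigen n y hy =>
    refine hmem (n + 1) y ?_
    rw [neg_lie, neg_eq_iff_eq_neg, ← neg_smul] at hy
    rw [hy]
    congr 1
    push_cast
    ring
  | zero => exact zero_mem _
  | add y z _ _ hy hz => exact add_mem hy hz

theorem map_mem_positivePart_neg {ρ x : 𝔤} {D : 𝔤 →ₗ⁅ℂ⁆ 𝔤} (hD : ∀ x, ⁅ρ, D x⁆ = -D ⁅ρ, x⁆)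
    (hx : x ∈ positivePart ρ) : D x ∈ positivePart (-ρ) := by
  induction hx using positivePart_induction with
  | eigen n y hy =>
    refine mem_positivePart_of_lie_eq n ?_
    rw [neg_lie, hD, hy, map_smul, neg_neg]
  | zero => simp
  | add y z _ _ hy hz => rw [map_add]; exact add_mem hy hz

/-- Invariance makes `ad ρ` skew for the Killing form, so `(k + m)⟨x, y⟩ = 0`. -/
theorem killingForm_eq_zero_of_lie_eq_smul {ρ x y : 𝔤} {k m : ℂ} (hkm : k + m ≠ 0)
    (hx : ⁅ρ, x⁆ = k • x) (hy : ⁅ρ, y⁆ = m • y) : killingForm ℂ 𝔤 x y = 0 := by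
  have h := LieModule.traceForm_apply_lie_apply ℂ 𝔤 𝔤 x ρ y
  rw [← lie_skew, hx, hy, map_neg, LinearMap.neg_apply, map_smul, map_smul,
    LinearMap.smul_apply] at h
  have h' : (k + m) • LieModule.traceForm ℂ 𝔤 𝔤 x y = 0 := by
    rw [add_smul, ← h, add_neg_cancel]
  exact (smul_eq_zero.mp h').resolve_left hkm

theorem killingForm_positivePart_of_lie_eq_zero {ρ x y : 𝔤} (hx : x ∈ positivePart ρ)
    (hy : ⁅ρ, y⁆ = 0) : killingForm ℂ 𝔤 x y = 0 := by
  induction hx using positivePart_induction with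
  | eigen n x hx =>
    exact killingForm_eq_zero_of_lie_eq_smul (m := 0) (by simpa using n.cast_add_one_ne_zero) hx
      (by simpa using hy)
  | zero => simp
  | add x z _ _ hx hz => rw [map_add, LinearMap.add_apply, hx, hz, add_zero]

theorem killingForm_positivePart {ρ x y : 𝔤} (hx : x ∈ positivePart ρ)
    (hy : y ∈ positivePart ρ) : killingForm ℂ 𝔤 x y = 0 := by
  induction hx using positivePart_induction with
  | eigen m x hx =>
    induction hy using positivePart_induction with
    | eigen n y hy =>
      refine killingForm_eq_zero_of_lie_eq_smul ?_ hx hy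
      have := (m + n + 1).cast_add_one_ne_zero (R := ℂ)
      push_cast at this
      convert this using 1
      ring
    | zero => simp
    | add y z _ _ hy hz => rw [map_add, hy, hz, add_zero]
  | zero => simp
  | add x z _ _ hx hz => rw [map_add, LinearMap.add_apply, hx, hz, add_zero]

end Grading

/-! ### Triangular decomposition, parabolic subalgebras and the Killing form. -/

section Triangular

variable {ι 𝔤 : Type*} [Fintype ι] [LieRing 𝔤] [LieAlgebra ℂ 𝔤] {H : LieSubalgebra ℂ 𝔤}

theorem lie_eq_zero_of_mem_cartan (b : LieAlgebra.Basis ι H) {x y : 𝔤} (hx : x ∈ H)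
    (hy : y ∈ H) : ⁅x, y⁆ = 0 := by
  have := b.isLieAbelian_cartan
  simpa using congrArg Subtype.val (trivial_lie_zero H H ⟨x, hx⟩ ⟨y, hy⟩)

/-- The Cartan matrix is invertible over `ℂ`, so the simple roots take arbitrary prescribed values
on some `ρ = ∑ v_j h_j`. -/
theorem exists_mem_cartan_lie_eq (b : LieAlgebra.Basis ι H) (d : ι → ℂ) :
    ∃ ρ ∈ H, (∀ i, ⁅ρ, b.e i⁆ = d i • b.e i) ∧ ∀ i, ⁅-ρ, b.f i⁆ = d i • b.f i := by
  classical
  have hdet : IsUnit (b.A.map (Int.cast : ℤ → ℂ)).det := by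
    have : (b.A.map (Int.cast : ℤ → ℂ)).det = (b.A.det : ℂ) :=
      ((Int.castRingHom ℂ).map_det b.A).symm
    rw [isUnit_iff_ne_zero, this]
    exact_mod_cast b.nondegen.det_ne_zero
  set v := (b.A.map (Int.cast : ℤ → ℂ))⁻¹.mulVec d with hv
  have hAv : (b.A.map (Int.cast : ℤ → ℂ)).mulVec v = d := by
    rw [hv, Matrix.mulVec_mulVec, Matrix.mul_nonsing_inv _ hdet, Matrix.one_mulVec]
  have hd : ∀ i, ∑ j, v j * (b.A i j : ℂ) = d i := fun i => by
    rw [← hAv, Matrix.mulVec, dotProduct]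
    exact Finset.sum_congr rfl fun j _ => mul_comm _ _
  refine ⟨∑ j, v j • b.h j, sum_mem fun j _ => H.smul_mem _ (b.h' j).2, fun i => ?_, fun i => ?_⟩
  · rw [sum_lie, ← hd, Finset.sum_smul]
    refine Finset.sum_congr rfl fun j _ => ?_
    rw [smul_lie, b.lie_h_e, mul_smul, Int.cast_smul_eq_zsmul]
  · rw [neg_lie, sum_lie, ← hd, Finset.sum_smul, ← Finset.sum_neg_distrib]
    refine Finset.sum_congr rfl fun j _ => ?_
    rw [smul_lie, b.lie_h_f, mul_smul, Int.cast_smul_eq_zsmul, neg_smul, smul_neg, neg_neg]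

theorem exists_add_add_eq (b : LieAlgebra.Basis ι H) (x : 𝔤) :
    ∃ h ∈ H, ∃ v ∈ nilNeg b, ∃ u ∈ nilPos b, h + v + u = x := by
  have h := congrArg LieSubmodule.toSubmodule b.iSup_cartan_borelLower_borelUpper_eq_top
  have h' : H.toSubmodule ⊔ nilNeg b ⊔ nilPos b = ⊤ := by
    simpa [iSup_fin_three, nilNeg, nilPos] using h
  have hx : x ∈ H.toSubmodule ⊔ nilNeg b ⊔ nilPos b := h' ▸ Submodule.mem_top
  obtain ⟨a, ha, u, hu, rfl⟩ := Submodule.mem_sup.mp hx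
  obtain ⟨h, hh, v, hv, rfl⟩ := Submodule.mem_sup.mp ha
  exact ⟨h, hh, v, hv, u, hu, rfl⟩

theorem lie_eq_zero_of_mem_lieSpan {ρ x : 𝔤} {s : Set 𝔤} (hs : ∀ y ∈ s, ⁅ρ, y⁆ = 0)
    (hx : x ∈ LieSubalgebra.lieSpan ℂ 𝔤 s) : ⁅ρ, x⁆ = 0 := by
  induction hx using LieSubalgebra.lieSpan_induction with
  | mem y hy => exact hs y hy
  | zero => simp
  | add y z _ _ hy hz => rw [lie_add, hy, hz, add_zero]
  | smul t y _ hy => rw [lie_smul, hy, smul_zero]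
  | lie y z _ _ hy hz => rw [leibniz_lie, hy, hz, zero_lie, lie_zero, add_zero]

/-- The right-hand side contains every `e_i` and is closed under brackets: its first summand
commutes with `ρ`, so bracketing with it preserves degrees. -/
theorem nilPos_le_lieSpan_sup_positivePart (b : LieAlgebra.Basis ι H) {J : Set ι} {ρ : 𝔤}
    (h0 : ∀ i ∈ J, ⁅ρ, b.e i⁆ = 0) (h1 : ∀ i, i ∉ J → ⁅ρ, b.e i⁆ = b.e i) :
    nilPos b ≤ (LieSubalgebra.lieSpan ℂ 𝔤 (b.e '' J)).toSubmodule ⊔ positivePart ρ := by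
  intro x hx
  replace hx : x ∈ LieSubalgebra.lieSpan ℂ 𝔤 (Set.range b.e) := hx
  induction hx using LieSubalgebra.lieSpan_induction with
  | mem y hy =>
    obtain ⟨i, rfl⟩ := hy
    by_cases hi : i ∈ J
    · exact Submodule.mem_sup_left (LieSubalgebra.subset_lieSpan ⟨i, hi, rfl⟩)
    · exact Submodule.mem_sup_right (mem_positivePart_of_lie_eq 0 (by simp [h1 i hi]))
  | zero => exact zero_mem _
  | add y z _ _ hy hz => exact add_mem hy hz
  | smul t y _ hy => exact Submodule.smul_mem _ t hy
  | lie y z _ _ hy hz =>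
    have hs : ∀ w ∈ b.e '' J, ⁅ρ, w⁆ = 0 := by
      rintro _ ⟨i, hi, rfl⟩
      exact h0 i hi
    obtain ⟨y₀, hy₀, y₁, hy₁, rfl⟩ := Submodule.mem_sup.mp hy
    obtain ⟨z₀, hz₀, z₁, hz₁, rfl⟩ := Submodule.mem_sup.mp hz
    rw [add_lie, lie_add, lie_add, ← lie_skew y₁ z₀]
    refine add_mem (add_mem ?_ ?_) (add_mem ?_ ?_)
    · exact Submodule.mem_sup_left (LieSubalgebra.lie_mem _ hy₀ hz₀)
    · exact Submodule.mem_sup_right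
        (lie_mem_positivePart_of_lie_eq_zero (lie_eq_zero_of_mem_lieSpan hs hy₀) hz₁)
    · exact Submodule.mem_sup_right (neg_mem
        (lie_mem_positivePart_of_lie_eq_zero (lie_eq_zero_of_mem_lieSpan hs hz₀) hy₁))
    · exact Submodule.mem_sup_right (lie_mem_positivePart hy₁ hz₁)

theorem nilPos_le_positivePart (b : LieAlgebra.Basis ι H) {ρ : 𝔤}
    (h : ∀ i, ⁅ρ, b.e i⁆ = b.e i) : nilPos b ≤ positivePart ρ := by
  have := nilPos_le_lieSpan_sup_positivePart b (J := ∅) (by simp) fun i _ => h i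
  simpa using this

/-- With every `e_i` in degree 1, `x` has only positive degrees and `y` only nonnegative ones, so no
two of their degrees sum to zero. -/
theorem killingForm_nilPos (b : LieAlgebra.Basis ι H) {x y : 𝔤} (hx : x ∈ nilPos b)
    (hy : y ∈ borelPos b) : killingForm ℂ 𝔤 x y = 0 := by
  obtain ⟨ρ, hρ, he, -⟩ := exists_mem_cartan_lie_eq b 1
  have hle := nilPos_le_positivePart b (ρ := ρ) fun i => by simpa using he i
  obtain ⟨h, hh, u, hu, rfl⟩ := Submodule.mem_sup.mp hy
  rw [map_add, killingForm_positivePart (hle hx) (hle hu),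
    killingForm_positivePart_of_lie_eq_zero (hle hx) (lie_eq_zero_of_mem_cartan b hρ hh), add_zero]

variable [FiniteDimensional ℂ 𝔤] [LieAlgebra.IsSemisimple ℂ 𝔤]

/-- An element orthogonal to the subalgebra generated by the `f_i` with `i ∈ J` has its upper
nilpotent component in the nilradical of the standard parabolic attached to `J`. -/
theorem mem_positivePart_of_killingForm_eq_zero (b : LieAlgebra.Basis ι H) {J : Set ι} {ρ : 𝔤}
    (he0 : ∀ i ∈ J, ⁅ρ, b.e i⁆ = 0) (he1 : ∀ i, i ∉ J → ⁅ρ, b.e i⁆ = b.e i)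
    (hf0 : ∀ i ∈ J, ⁅-ρ, b.f i⁆ = 0) (hf1 : ∀ i, i ∉ J → ⁅-ρ, b.f i⁆ = b.f i)
    {h u v : 𝔤} (hh : h ∈ H) (hu : u ∈ nilPos b) (hv : v ∈ nilNeg b)
    (hk : ∀ z ∈ LieSubalgebra.lieSpan ℂ 𝔤 (b.f '' J), killingForm ℂ 𝔤 (h + u + v) z = 0) :
    u ∈ positivePart ρ := by
  obtain ⟨u₀, hu₀, u₁, hu₁, rfl⟩ :=
    Submodule.mem_sup.mp (nilPos_le_lieSpan_sup_positivePart b he0 he1 hu)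
  -- The component `u₀`, which lies in the subalgebra generated by the `e_i` with `i ∈ J`, is shown
  -- to be orthogonal to all of `𝔤`. By degree, only the part `p₀` of the test vector generated by
  -- the `f_i` with `i ∈ J` can pair with it, and there `hk` applies.
  suffices u₀ = 0 by rwa [this, zero_add]
  have hρu₀ : ⁅ρ, u₀⁆ = 0 := by
    refine lie_eq_zero_of_mem_lieSpan ?_ hu₀
    rintro _ ⟨i, hi, rfl⟩
    exact he0 i hi
  have hu₀' : u₀ ∈ nilPos b := LieSubalgebra.lieSpan_mono (Set.image_subset_range b.e J) hu₀
  refine (LieAlgebra.IsKilling.killingForm_nondegenerate ℂ 𝔤).1 _ fun z => ?_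
  obtain ⟨a, ha, p, hp, q, hq, rfl⟩ := exists_add_add_eq b z
  -- Passing to `b.symm` exchanges `e` and `f`, so the negative half is graded by `-ρ`.
  obtain ⟨p₀, hp₀, p₁, hp₁, rfl⟩ :=
    Submodule.mem_sup.mp (nilPos_le_lieSpan_sup_positivePart b.symm hf0 hf1 hp)
  replace hp₀ : p₀ ∈ LieSubalgebra.lieSpan ℂ 𝔤 (b.f '' J) := hp₀
  have hρp₀ : ⁅ρ, p₀⁆ = 0 := by
    refine lie_eq_zero_of_mem_lieSpan ?_ hp₀
    rintro _ ⟨i, hi, rfl⟩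
    simpa only [neg_lie, neg_eq_zero] using hf0 i hi
  have hp₀' : p₀ ∈ nilPos b.symm :=
    LieSubalgebra.lieSpan_mono (Set.image_subset_range b.f J) hp₀
  have k1 : killingForm ℂ 𝔤 u₀ a = 0 := killingForm_nilPos b hu₀' (Submodule.mem_sup_left ha)
  have k2 : killingForm ℂ 𝔤 u₀ q = 0 := killingForm_nilPos b hu₀' (Submodule.mem_sup_right hq)
  have k3 : killingForm ℂ 𝔤 u₀ p₁ = 0 := by
    rw [LieModule.traceForm_comm]
    exact killingForm_positivePart_of_lie_eq_zero hp₁ (by rw [neg_lie, hρu₀, neg_zero])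
  have k4 : killingForm ℂ 𝔤 h p₀ = 0 := by
    rw [LieModule.traceForm_comm]
    exact killingForm_nilPos b.symm hp₀' (Submodule.mem_sup_left hh)
  have k5 : killingForm ℂ 𝔤 v p₀ = 0 :=
    killingForm_nilPos b.symm hv (Submodule.mem_sup_right hp₀')
  have k6 : killingForm ℂ 𝔤 u₁ p₀ = 0 := killingForm_positivePart_of_lie_eq_zero hu₁ hρp₀
  have k7 : killingForm ℂ 𝔤 u₀ p₀ = 0 := by
    have := hk p₀ hp₀
    simpa [k4, k5, k6] using this
  simp [k1, k2, k3, k7]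

end Triangular

/-! ### The involution and the annihilator of its fixed points. -/

section Involution

variable {ι 𝔤 : Type*} [Fintype ι] [LieRing 𝔤] [LieAlgebra ℂ 𝔤]
  [FiniteDimensional ℂ 𝔤] [LieAlgebra.IsSemisimple ℂ 𝔤] {H : LieSubalgebra ℂ 𝔤}

/-- Elements orthogonal to the fixed points of an involutive automorphism are anti-invariant, and
conversely. -/
theorem forall_killingForm_fixed_eq_zero_iff {D : 𝔤 →ₗ⁅ℂ⁆ 𝔤} (hD : ∀ x, D (D x) = x) (w : 𝔤) :
    (∀ z, D z = z → killingForm ℂ 𝔤 w z = 0) ↔ D w = -w := by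
  have hinv : ∀ x y, killingForm ℂ 𝔤 (D x) (D y) = killingForm ℂ 𝔤 x y :=
    LieAlgebra.killingForm_of_equiv_apply (R := ℂ)
      (e := ({ D with invFun := D, left_inv := hD, right_inv := hD } : 𝔤 ≃ₗ⁅ℂ⁆ 𝔤))
  constructor
  · intro h
    refine eq_neg_of_add_eq_zero_left
      ((LieAlgebra.IsKilling.killingForm_nondegenerate ℂ 𝔤).1 _ fun z => ?_)
    -- The vector `D z + z` is fixed, and invariance of the form rewrites its pairing with `w` as
    -- that of `D w + w` with `z`.
    have := h (D z + z) (by rw [map_add, hD, add_comm])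
    rw [map_add, ← hinv w (D z), hD] at this
    rwa [map_add, LinearMap.add_apply]
  · intro h z hz
    have := hinv w z
    rw [h, hz, map_neg, LinearMap.neg_apply] at this
    exact self_eq_neg.mp this.symm

omit [FiniteDimensional ℂ 𝔤] [LieAlgebra.IsSemisimple ℂ 𝔤] in
-- By the Leibniz rule the elements with this property form a Lie subalgebra, and the `e_i` and
-- `f_i` generate `𝔤`.
theorem lie_apply_eq_neg_of_generators (b : LieAlgebra.Basis ι H) {D : 𝔤 →ₗ⁅ℂ⁆ 𝔤} {ρ : 𝔤}
    (he : ∀ i, ⁅ρ, D (b.e i)⁆ = -D ⁅ρ, b.e i⁆) (hf : ∀ i, ⁅ρ, D (b.f i)⁆ = -D ⁅ρ, b.f i⁆)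
    (x : 𝔤) : ⁅ρ, D x⁆ = -D ⁅ρ, x⁆ := by
  have hx : x ∈ LieSubalgebra.lieSpan ℂ 𝔤 (Set.range b.e ∪ Set.range b.f) := by simp [b.span_ef]
  induction hx using LieSubalgebra.lieSpan_induction with
  | mem y hy =>
    obtain ⟨i, rfl⟩ | ⟨i, rfl⟩ := hy
    · exact he i
    · exact hf i
  | zero => simp
  | add y z _ _ hy hz => rw [map_add, lie_add, lie_add, hy, hz, map_add, neg_add]
  | smul t y _ hy => rw [map_smul, lie_smul, lie_smul, hy, map_smul, smul_neg]
  | lie y z _ _ hy hz =>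
    rw [D.map_lie y z, leibniz_lie, leibniz_lie ρ y z, hy, hz, map_add, D.map_lie ⁅ρ, y⁆ z,
      D.map_lie y ⁅ρ, z⁆, neg_lie, lie_neg, neg_add]

omit [FiniteDimensional ℂ 𝔤] [LieAlgebra.IsSemisimple ℂ 𝔤] in
theorem exists_eq_add_of_mem_dualSubalgebra (b : LieAlgebra.Basis ι H) (x : dualSubalgebra b) :
    ∃ h ∈ H, ∃ u ∈ nilPos b, ∃ v ∈ nilNeg b,
      (x : 𝔤 × 𝔤).1 = h + u ∧ (x : 𝔤 × 𝔤).2 = -h + v := by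
  obtain ⟨⟨X, Y⟩, hX, hY, hXY⟩ := x
  obtain ⟨h, hh, u, hu, rfl⟩ := Submodule.mem_sup.mp hX
  obtain ⟨k, hk, v, hv, rfl⟩ := Submodule.mem_sup.mp hY
  obtain ⟨w, hw, z, hz, hwz⟩ := Submodule.mem_sup.mp hXY
  simp only at hwz
  obtain ⟨h0, -, -⟩ := triangular_indep b (h := h + k) (v := v - w) (u := u - z) (add_mem hh hk)
    (sub_mem hu hz) (sub_mem hv hw) (by
      rw [show h + k + (v - w) + (u - z) = h + u + (k + v) - (w + z) by abel, hwz, sub_self])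
  exact ⟨h, hh, u, hu, v, hv, rfl, congrArg (· + v) (eq_neg_of_add_eq_zero_right h0)⟩

theorem toDualLie_mem_annihilator_iff (b : LieAlgebra.Basis ι H) (𝔨 : Set 𝔤)
    (x : dualSubalgebra b) :
    toDualLie b x ∈ annihilator b 𝔨 ↔
      ∀ X ∈ 𝔨, killingForm ℂ 𝔤 ((x : 𝔤 × 𝔤).1 - (x : 𝔤 × 𝔤).2) X = 0 :=
  (mem_annihilator b 𝔨 (toDualMap b x)).trans
    (forall₂_congr fun X _ => by rw [toDualMap_apply'])

variable [DecidableEq ι] {b : LieAlgebra.Basis ι H} {S : SatakeDiagram b.A} {c : ι → ℂ} {l : List ι}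
  {θ : AdjointGroup 𝔤 ≃* AdjointGroup 𝔤} {D : 𝔤 →ₗ⁅ℂ⁆ 𝔤}

theorem IsSatakeInvolution.map_e_black (hθ : IsSatakeInvolution b S c l θ)
    (hD : IsInducedLieHom θ D) {i : ι} (hi : i ∈ S.black) : D (b.e i) = b.e i :=
  eq_of_adjExp_smul_eq fun t => by
    rw [← hD.adjExp_smul]
    exact hθ.x_black i hi t

theorem IsSatakeInvolution.map_f_black (hθ : IsSatakeInvolution b S c l θ)
    (hD : IsInducedLieHom θ D) {i : ι} (hi : i ∈ S.black) : D (b.f i) = b.f i :=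
  eq_of_adjExp_smul_eq fun t => by
    rw [← hD.adjExp_smul]
    exact hθ.y_black i hi t

/-- The involution of a Satake diagram reverses the grading in which black simple root vectors have
degree zero and white ones have degree one. -/
theorem IsSatakeInvolution.lie_map_eq_neg (hθ : IsSatakeInvolution b S c l θ)
    (hD : IsInducedLieHom θ D) (hl : ∀ i ∈ l, i ∈ S.black) {ρ : 𝔤}
    (he0 : ∀ i ∈ S.black, ⁅ρ, b.e i⁆ = 0) (he1 : ∀ i, i ∉ S.black → ⁅ρ, b.e i⁆ = b.e i)
    (hf0 : ∀ i ∈ S.black, ⁅ρ, b.f i⁆ = 0) (hf1 : ∀ i, i ∉ S.black → ⁅ρ, b.f i⁆ = -b.f i)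
    (x : 𝔤) : ⁅ρ, D x⁆ = -D ⁅ρ, x⁆ := by
  have hw := commute_ad_wordLift b (fun i hi => he0 i (hl i hi)) fun i hi => hf0 i (hl i hi)
  have hτ : ∀ i, i ∉ S.black → S.τ i ∉ S.black := fun i hi => mt (S.τ_black i).mp hi
  refine lie_apply_eq_neg_of_generators b (fun i => ?_) (fun i => ?_) x
  · by_cases hi : i ∈ S.black
    · rw [hθ.map_e_black hD hi, he0 i hi, map_zero, neg_zero]
    · rw [he1 i hi, ← neg_one_smul ℂ]
      -- `D e_i` is the conjugate of `c_i f_{τ i}` by the lift of `w_•`. The lift commutes with `ad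
      -- ρ` and `τ i` is white, so the weight is -1.
      refine lie_eq_smul_of_adjExp_smul (Y := c i • b.f (S.τ i)) hw ?_ fun t => ?_
      · rw [lie_smul, hf1 _ (hτ i hi), smul_neg, neg_one_smul]
      · rw [← hD.adjExp_smul, smul_smul, mul_comm t]
        exact hθ.x_white i hi t
  · by_cases hi : i ∈ S.black
    · rw [hθ.map_f_black hD hi, hf0 i hi, map_zero, neg_zero]
    · rw [hf1 i hi, map_neg, neg_neg]
      refine (lie_eq_smul_of_adjExp_smul (k := 1) (Y := c i • b.e (S.τ i)) hw ?_
        fun t => ?_).trans (one_smul ℂ _)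
      · rw [lie_smul, he1 _ (hτ i hi), one_smul]
      · rw [← hD.adjExp_smul, smul_smul, mul_comm t]
        exact hθ.y_white i hi t

/-- Anti-invariance of the difference is a single equation in `𝔤`; the grading splits it into enough
components to recover both entries of the pair. -/
theorem IsSatakeInvolution.map_sub_eq_neg_iff (hθ : IsSatakeInvolution b S c l θ)
    (hD : IsInducedLieHom θ D) (hl : ∀ i ∈ l, i ∈ S.black) (x : dualSubalgebra b) :
    D ((x : 𝔤 × 𝔤).1 - (x : 𝔤 × 𝔤).2) = -((x : 𝔤 × 𝔤).1 - (x : 𝔤 × 𝔤).2) ↔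
      (x : 𝔤 × 𝔤).1 = D (x : 𝔤 × 𝔤).2 := by
  classical
  have hDD := hD.apply_apply hθ.invol
  constructor
  swap
  · intro h
    rw [map_sub, h, hDD, neg_sub]
  intro hx
  obtain ⟨h, hh, u, hu, v, hv, h1, h2⟩ := exists_eq_add_of_mem_dualSubalgebra b x
  rw [h1, h2] at hx ⊢
  have hxe : h + u - (-h + v) = h + h + u + -v := by abel
  rw [hxe] at hx
  -- Anti-invariance is converted back to orthogonality to the fixed points, to be tested on the
  -- subalgebras generated by the black `f_i` and the black `e_i`.
  have hk := (forall_killingForm_fixed_eq_zero_iff hDD _).mpr hx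
  have hspan : ∀ s : Set 𝔤, (∀ y ∈ s, D y = y) →
      ∀ z ∈ LieSubalgebra.lieSpan ℂ 𝔤 s, D z = z := by
    intro s hs z hz
    induction hz using LieSubalgebra.lieSpan_induction with
    | mem y hy => exact hs y hy
    | zero => exact map_zero D
    | add y z _ _ hy hz => rw [map_add, hy, hz]
    | smul t y _ hy => rw [map_smul, hy]
    | lie y z _ _ hy hz => rw [LieHom.map_lie, hy, hz]
  obtain ⟨ρ, hρ, he, hf⟩ :=
    exists_mem_cartan_lie_eq b fun i => if i ∈ S.black then 0 else 1
  have he0 : ∀ i ∈ S.black, ⁅ρ, b.e i⁆ = 0 := fun i hi => by rw [he]; simp [hi]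
  have he1 : ∀ i, i ∉ S.black → ⁅ρ, b.e i⁆ = b.e i := fun i hi => by rw [he]; simp [hi]
  have hf0 : ∀ i ∈ S.black, ⁅-ρ, b.f i⁆ = 0 := fun i hi => by rw [hf]; simp [hi]
  have hf1 : ∀ i, i ∉ S.black → ⁅-ρ, b.f i⁆ = b.f i := fun i hi => by rw [hf]; simp [hi]
  have hup : u ∈ positivePart ρ :=
    mem_positivePart_of_killingForm_eq_zero b he0 he1 hf0 hf1 (add_mem hh hh) hu (neg_mem hv)
      fun z hz => hk z (hspan _ (by rintro _ ⟨i, hi, rfl⟩; exact hθ.map_f_black hD hi) z hz)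
  have hvp : v ∈ positivePart (-ρ) := by
    -- The same argument with `e` and `f` exchanged and `ρ` negated; it concerns `-v`, the lower
    -- component of the difference.
    rw [← neg_mem_iff]
    refine mem_positivePart_of_killingForm_eq_zero b.symm (J := S.black) hf0 hf1
      ((neg_neg ρ).symm ▸ he0) ((neg_neg ρ).symm ▸ he1)
      (add_mem hh hh) (neg_mem hv : -v ∈ nilNeg b) hu fun z hz => ?_
    rw [add_right_comm]
    exact hk z (hspan _ (by rintro _ ⟨i, hi, rfl⟩; exact hθ.map_e_black hD hi) z hz)
  have hanti := hθ.lie_map_eq_neg hD hl he0 he1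
    (fun i hi => by rw [← neg_eq_zero, ← neg_lie, hf0 i hi])
    (fun i hi => by
      rw [eq_neg_iff_add_eq_zero, ← neg_eq_zero, neg_add, ← neg_lie, hf1 i hi, add_neg_cancel])
  have hDu : D u ∈ positivePart (-ρ) := map_mem_positivePart_neg hanti hup
  have hDv : D v ∈ positivePart ρ := by
    have := map_mem_positivePart_neg (ρ := -ρ) (D := D)
      (fun y => by rw [neg_lie, hanti, neg_lie, map_neg]) hvp
    rwa [neg_neg] at this
  have hρh : ⁅ρ, h⁆ = 0 := lie_eq_zero_of_mem_cartan b hρ hh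
  -- The degree-zero, positive and negative parts of `D w + w = 0` are `D(2h) + 2h`, `u - D v` and
  -- `D u - v`.
  have huv : u - D v = 0 := by
    refine eq_zero_of_add_positivePart_add_positivePart_neg (a := D (h + h) + (h + h))
      (q := D u - v) ?_ (sub_mem hup hDv) (sub_mem hDu hvp) ?_
    · rw [lie_add, hanti, lie_add, hρh]
      simp
    · rw [map_add, map_add, map_neg] at hx
      refine Eq.trans ?_ (sub_eq_zero.mpr hx)
      abel
  have hu' : u = D v := sub_eq_zero.mp huv
  have hDh : D h = -h := by
    rw [hu', map_add, map_add, hDD, map_neg, map_add] at hx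
    have : (2 : ℂ) • (D h + h) = 0 := by
      refine Eq.trans ?_ (sub_eq_zero.mpr hx)
      module
    exact eq_neg_of_add_eq_zero_left ((smul_eq_zero.mp this).resolve_left two_ne_zero)
  rw [map_add, map_neg, hDh, neg_neg, ← hu']

end Involution

/-! ### Coisotropy of the fixed-point subgroup. -/

theorem mainTheorem2 {ι 𝔤 : Type*} [Fintype ι] [DecidableEq ι] [LieRing 𝔤] [LieAlgebra ℂ 𝔤]
    [FiniteDimensional ℂ 𝔤] [LieAlgebra.IsSemisimple ℂ 𝔤] {H : LieSubalgebra ℂ 𝔤}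
    (b : LieAlgebra.Basis ι H) (S : SatakeDiagram b.A)
    (c : ι → ℂ) (hc : ∀ i, i ∉ S.black → c i = 1 ∨ c i = -1)
    (l : List ι) (hl : IsReducedLongestWord b.A S.black l)
    (θ : AdjointGroup 𝔤 ≃* AdjointGroup 𝔤) (hθ : IsSatakeInvolution b S c l θ)
    (dθ : 𝔤 →ₗ⁅ℂ⁆ 𝔤) (hdθ : IsInducedLieHom θ dθ) :
    IsCoisotropic b (fixedSubgroup θ) ∧
      ∀ x : dualSubalgebra b,
        toDualLie b x ∈ annihilator b (lieAlgebraOf (fixedSubgroup θ)) ↔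
          (x : 𝔤 × 𝔤).1 = dθ (x : 𝔤 × 𝔤).2 := by
  have key : ∀ x : dualSubalgebra b,
      toDualLie b x ∈ annihilator b (lieAlgebraOf (fixedSubgroup θ)) ↔
        (x : 𝔤 × 𝔤).1 = dθ (x : 𝔤 × 𝔤).2 := fun x => by
    rw [toDualLie_mem_annihilator_iff, ← hθ.map_sub_eq_neg_iff hdθ hl.1 x,
      ← forall_killingForm_fixed_eq_zero_iff (hdθ.apply_apply hθ.invol)]
    exact forall_congr' fun X => by rw [hdθ.mem_lieAlgebraOf_fixedSubgroup]
  refine ⟨⟨{ annihilator b (lieAlgebraOf (fixedSubgroup θ)) with lie_mem' := ?_ }, rfl⟩, key⟩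
  intro f g hf hg
  obtain ⟨x, rfl⟩ := (toDualLie b).surjective f
  obtain ⟨y, rfl⟩ := (toDualLie b).surjective g
  have hxy : ⁅toDualLie b x, toDualLie b y⁆ = toDualLie b ⁅x, y⁆ := by
    change toDualLie b ⁅(toDualLie b).symm _, (toDualLie b).symm _⁆ = _
    rw [LinearEquiv.symm_apply_apply, LinearEquiv.symm_apply_apply]
  replace hf := (key x).mp hf
  replace hg := (key y).mp hg
  change ⁅toDualLie b x, toDualLie b y⁆ ∈ annihilator b (lieAlgebraOf (fixedSubgroup θ))
  -- Under the identification the bracket is componentwise, so closure reduces to `dθ` being a Lie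
  -- algebra homomorphism.
  rw [hxy, key]
  change ⁅(x : 𝔤 × 𝔤).1, (y : 𝔤 × 𝔤).1⁆ = dθ ⁅(x : 𝔤 × 𝔤).2, (y : 𝔤 × 𝔤).2⁆
  rw [hf, hg, LieHom.map_lie]
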